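/- Let $M$ be a loopless matroid of rank $r$ on the ground set $[n]=\{1,\dots,n\}$. Let $\mathcal B$ be the poset of all subsets $\sigma$ of $[n]$ with $\emptyset\neq\sigma\neq[n]$, ordered by inclusion (the proper part of the Boolean lattice). Let $\mathcal L\subseteq\mathcal B$ be the subposet of flats of $M$ in $\mathcal B$ (the proper part of the lattice of flats), and let $\mathcal{NS}\subseteq\mathcal B$ be the subposet of non-spanning sets, i.e. those $\sigma\in\mathcal B$ with $\operatorname{rk}(\sigma)<r$. For a poset $P$ let $\Delta(P)$ be its order complex, whose nonempty faces are the nonempty finite chains of $P$, and let $|\Delta(P)|$ be its geometric realization. For $P\subseteq\mathcal B$ regard $\Delta(P)$ as a subcomplex of $\Delta(\mathcal B)$. Write $\mathcal B\setminus\mathcal L$ for the topological space $|\Delta(\mathcal B)|\setminus|\Delta(\mathcal L)|$, and for $P\subseteq\mathcal B$ write $\mathcal B-P$ for the deletion of $\Delta(P)$ from $\Delta(\mathcal B)$, that is, the largest subcomplex of $\Delta(\mathcal B)$ whose underlying space is contained in $|\Delta(\mathcal B)|\setminus|\Delta(P)|$. Then there are homotopy equivalences $$\mathcal B\setminus\mathcal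 L\ \simeq\ \mathcal B-\mathcal L\ \simeq\ \mathcal B-\mathcal{NS},$$ and $$\dim(\mathcal B-\mathcal{NS})\ \le\ n-r-1,$$ where the complex with no nonempty face has dimension $-1$. -/

import Mathlib

namespace MatroidComplement

/-- The abstract order complex of a subposet `P` of `α`: its faces are the nonempty finite
chains of elements of `P`. -/
def chains {α : Type*} [PartialOrder α] (P : Set α) : PreAbstractSimplicialComplex α where
  faces := {c | c.Nonempty ∧ (∀ a ∈ c, a ∈ P) ∧ IsChain (· ≤ ·) (c : Set α)}
  isRelLowerSet_faces := fun _ hc => ⟨hc.1, fun _ hdc hd =>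
    ⟨hd, fun a ha => hc.2.1 a (hdc ha), hc.2.2.mono (Finset.coe_subset.2 hdc)⟩⟩

/-- The order complex `Δ(P)` of a subposet `P` of a finite poset `α`, realized in `ℝ^α`: the
vertex `a ∈ P` is placed at the standard basis vector `e_a`, and the faces are the simplices
spanned by the nonempty chains of `P`. In particular `Δ(Q)` is a subcomplex of `Δ(P)` whenever
`Q ⊆ P`. The realization is `(orderComplex P).space`, with the subspace topology. -/
noncomputable def orderComplex {α : Type*} [PartialOrder α] [Fintype α] [DecidableEq α]
    (P : Set α) : Geometry.SimplicialComplex ℝ (α → ℝ) :=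
  Geometry.SimplicialComplex.ofAffineIndependent
    ((chains P).map (fun a => (Pi.single a (1 : ℝ) : α → ℝ)))
    (by
      refine (Pi.linearIndependent_single_one α ℝ).affineIndependent.range.mono fun x hx => ?_
      simp only [Set.mem_iUnion, Finset.mem_coe] at hx
      obtain ⟨_, ⟨_, _, rfl⟩, hx⟩ := hx
      obtain ⟨a, _, rfl⟩ := Finset.mem_image.1 hx
      exact ⟨a, rfl⟩)

/-- The combinatorial restriction of a complex `X` to a set `A`: the inclusion-wise maximal
subcomplex of `X` that is contained in `A`. It consists of the faces of `X` lying in `A`. -/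
def restriction {E : Type*} [AddCommGroup E] [Module ℝ E]
    (X : Geometry.SimplicialComplex ℝ E) (A : Set E) : Geometry.SimplicialComplex ℝ E where
  faces := {s | s ∈ X.faces ∧ convexHull ℝ (s : Set E) ⊆ A}
  isRelLowerSet_faces := fun _ hs => ⟨X.nonempty_of_mem_faces hs.1, fun _ hts ht =>
    ⟨X.down_closed hs.1 hts ht, (convexHull_mono (Finset.coe_subset.2 hts)).trans hs.2⟩⟩
  indep := fun hs => X.indep hs.1
  inter_subset_convexHull := fun hs ht => X.inter_subset_convexHull hs.1 ht.1

/-- The deletion `X - D` of a subcomplex `D` from a complex `X`: the maximal subcomplex of `X`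
contained in the set-theoretic complement `|X| \ |D|`. -/
def deletion {E : Type*} [AddCommGroup E] [Module ℝ E]
    (X D : Geometry.SimplicialComplex ℝ E) : Geometry.SimplicialComplex ℝ E :=
  restriction X (X.space \ D.space)

/-- `X` has dimension at most `d`, where a face with `k` vertices has dimension `k - 1`.
The complex without nonempty faces has dimension `-1`, so it satisfies this for `d = -1`. -/
def DimLE {E : Type*} [AddCommGroup E] [Module ℝ E]
    (X : Geometry.SimplicialComplex ℝ E) (d : ℤ) : Prop :=
  ∀ s ∈ X.faces, (s.card : ℤ) - 1 ≤ d

/-- The proper part of the Boolean lattice on `[n]`: subsets other than `∅` and `[n]`. -/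
def properBoolean (n : ℕ) : Set (Finset (Fin n)) :=
  {s | s ≠ ∅ ∧ s ≠ Finset.univ}

/-- The proper part of the lattice of flats of a loopless matroid on `[n]`: the flats other than
the bottom flat `∅` and the top flat `[n]`. -/
def properFlats {n : ℕ} (M : Matroid (Fin n)) : Set (Finset (Fin n)) :=
  {s | s ∈ properBoolean n ∧ M.IsFlat (s : Set (Fin n))}

/-- The poset of non-spanning subsets in the proper part of the Boolean lattice: the nonempty
proper subsets of `[n]` of rank less than the rank of the matroid. -/
def nonSpanning {n : ℕ} (M : Matroid (Fin n)) : Set (Finset (Fin n)) :=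
  {s | s ∈ properBoolean n ∧ M.eRk (s : Set (Fin n)) < M.eRank}

end MatroidComplement

/-! Points of `|Δ(Q)|` are probability vectors supported on chains of `Q`. On the complement of
`|Δ(P)|` some coordinate outside `P` is positive, so fading out the `P`-coordinates and
renormalising retracts it onto `|Δ(Q \ P)|`, which is the deletion (`deletion_orderComplex`,
`nonempty_homotopyEquiv_complement`).

For the second equivalence, choose `a s ∈ cl s \ s` for each non-flat `s` and send a chain `c` of
non-flats to the complement of `{a s | s ∈ c}`. This set is spanning
(`spanning_compl_image_of_isChain`), contains the minimum of `c`, and shrinks as `c` grows. Such a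
map on chains, applied to the superlevel sets of a point, is homotopic to the identity
(`IsChainMap.realization_homotopic_id`), and it restricts well to proper spanning sets, which are
all non-flats.

The dimension bound holds because a proper spanning set has between `r` and `n - 1` elements, and
cardinality is injective on a chain. -/

namespace MatroidComplement

open Finset

/-! ### Normalised weighted sums of vertices. -/

section WeightedPoint

variable {α : Type*} [DecidableEq α] {ι : Type*} [Fintype ι] {v : ι → α} {w : ι → ℝ}

/-- The point with barycentric coordinates proportional to the weights `w i` at the vertices
`v i`. -/
noncomputable def weightedPoint {ι : Type*} [Fintype ι] (v : ι → α) (w : ι → ℝ) : α → ℝ :=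
  fun a => (∑ i, w i)⁻¹ * ∑ i, if v i = a then w i else 0

lemma sum_pos_of_exists (h0 : ∀ i, 0 ≤ w i) (h : ∃ i, 0 < w i) : 0 < ∑ i, w i :=
  Finset.sum_pos' (fun i _ => h0 i) (h.imp fun _ hi => ⟨Finset.mem_univ _, hi⟩)

lemma exists_of_weightedPoint_ne_zero (h0 : ∀ i, 0 ≤ w i) {a : α}
    (ha : weightedPoint v w a ≠ 0) : ∃ i, v i = a ∧ 0 < w i := by
  by_contra! h
  refine ha ?_
  refine mul_eq_zero_of_right _ (Finset.sum_eq_zero fun i _ => ?_)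
  split_ifs with hi
  · exact le_antisymm (h i hi) (h0 i)
  · rfl

lemma weightedPoint_pos (h0 : ∀ i, 0 ≤ w i) {i : ι} (hi : 0 < w i) :
    0 < weightedPoint v w (v i) := by
  refine mul_pos (inv_pos.2 (sum_pos_of_exists h0 ⟨i, hi⟩))
    (sum_pos_of_exists (fun j => ?_) ⟨i, by simpa⟩)
  split_ifs
  exacts [h0 j, le_rfl]

lemma continuous_weightedPoint {Y : Type*} [TopologicalSpace Y] {w : Y → ι → ℝ}
    (hw : ∀ i, Continuous fun y => w y i) (hpos : ∀ y, 0 < ∑ i, w y i) :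
    Continuous fun y => weightedPoint v (w y) := by
  refine continuous_pi fun a => ?_
  refine ((continuous_finsetSum _ fun i _ => hw i).inv₀ fun y => (hpos y).ne').mul
    (continuous_finsetSum _ fun i _ => ?_)
  split_ifs
  exacts [hw i, continuous_const]

/-- Used to evaluate homotopies at their ends, where one of two families of weights vanishes. -/
lemma weightedPoint_sumElim_zero_left {κ : Type*} [Fintype κ] (u : κ → α) :
    weightedPoint (Sum.elim u v) (Sum.elim 0 w) = weightedPoint v w := by
  ext a
  simp only [weightedPoint, Fintype.sum_sum_type, Sum.elim_inl, Sum.elim_inr, Pi.zero_apply,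
    Finset.sum_const_zero, zero_add]
  refine congrArg _ ((congrArg (· + _) (Finset.sum_eq_zero fun i _ => ?_)).trans (zero_add _))
  exact ite_self _

lemma weightedPoint_sumElim_zero_right {κ : Type*} [Fintype κ] (u : κ → α) :
    weightedPoint (Sum.elim v u) (Sum.elim w 0) = weightedPoint v w := by
  ext a
  simp only [weightedPoint, Fintype.sum_sum_type, Sum.elim_inl, Sum.elim_inr, Pi.zero_apply,
    Finset.sum_const_zero, add_zero]
  refine congrArg _ ((congrArg (_ + ·) (Finset.sum_eq_zero fun i _ => ?_)).trans (add_zero _))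
  exact ite_self _

end WeightedPoint

section Hull

variable {α : Type*} [Fintype α] [DecidableEq α]

lemma weightedPoint_id {x : α → ℝ} (hx : ∑ a, x a = 1) : weightedPoint id x = x := by
  ext a
  simp [weightedPoint, hx]

lemma mem_convexHull_image_single {c : Finset α} {x : α → ℝ} :
    x ∈ convexHull ℝ ((c.image fun a => (Pi.single a (1 : ℝ) : α → ℝ) : Finset (α → ℝ)) :
      Set (α → ℝ)) ↔ (∀ a, 0 ≤ x a) ∧ ∑ a, x a = 1 ∧ ∀ a, x a ≠ 0 → a ∈ c := by
  constructor
  · intro hx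
    have hconv : Convex ℝ {x : α → ℝ | (∀ a, 0 ≤ x a) ∧ ∑ a, x a = 1 ∧ ∀ a, x a ≠ 0 → a ∈ c} := by
      rintro x ⟨hx0, hx1, hxc⟩ y ⟨hy0, hy1, hyc⟩ s t hs ht hst
      refine ⟨fun a => ?_, ?_, fun a ha => ?_⟩
      · simp only [Pi.add_apply, Pi.smul_apply, smul_eq_mul]
        have := hx0 a
        have := hy0 a
        positivity
      · simp [Finset.sum_add_distrib, ← Finset.mul_sum, hx1, hy1, hst]
      · by_contra hac
        have h1 : x a = 0 := by_contra fun h => hac (hxc a h)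
        have h2 : y a = 0 := by_contra fun h => hac (hyc a h)
        simp [h1, h2] at ha
    refine convexHull_min ?_ hconv hx
    intro y hy
    obtain ⟨a, ha, rfl⟩ := Finset.mem_image.1 (Finset.mem_coe.1 hy)
    refine ⟨fun b => ?_, by simp, fun b hb => ?_⟩
    · by_cases h : b = a
      · subst h; simp
      · simp [h]
    · by_cases h : b = a
      · exact h ▸ ha
      · simp [h] at hb
  · rintro ⟨h0, h1, hc⟩
    have hzero : ∀ a, a ∉ c → x a = 0 := fun a ha => by_contra fun h => ha (hc a h)
    have hx : x = ∑ a ∈ c, x a • (Pi.single a (1 : ℝ) : α → ℝ) := by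
      ext b
      simp only [Finset.sum_apply, Pi.smul_apply, smul_eq_mul, Pi.single_apply, mul_ite, mul_one,
        mul_zero, Finset.sum_ite_eq]
      split_ifs with h
      · rfl
      · exact hzero b h
    rw [hx]
    refine (convex_convexHull ℝ _).sum_mem (fun a _ => h0 a) ?_ fun a ha => subset_convexHull ℝ _ ?_
    · rw [← h1]
      exact Finset.sum_subset (Finset.subset_univ c) fun a _ ha => hzero a ha
    · exact Finset.mem_coe.2 (Finset.mem_image_of_mem _ ha)

end Hull

/-! ### Realizations in barycentric coordinates, deletions and complements. -/

section Realization

variable {α : Type*} [PartialOrder α] [Fintype α] [DecidableEq α] {P Q : Set α}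

lemma mem_faces_orderComplex {s : Finset (α → ℝ)} :
    s ∈ (orderComplex P).faces ↔ ∃ c : Finset α, (c.Nonempty ∧ (∀ a ∈ c, a ∈ P) ∧
      IsChain (· ≤ ·) (c : Set α)) ∧ c.image (fun a => (Pi.single a (1 : ℝ) : α → ℝ)) = s :=
  Iff.rfl

/-- The points of `|Δ(P)|` are the probability vectors supported on a chain of `P`. -/
lemma mem_space_orderComplex {x : α → ℝ} :
    x ∈ (orderComplex P).space ↔ (∀ a, 0 ≤ x a) ∧ ∑ a, x a = 1 ∧
      ∀ a b, x a ≠ 0 → x b ≠ 0 → a ∈ P ∧ (a ≤ b ∨ b ≤ a) := by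
  rw [Geometry.SimplicialComplex.mem_space_iff]
  constructor
  · rintro ⟨_, hs, hx⟩
    obtain ⟨c, ⟨-, hcP, hc⟩, rfl⟩ := mem_faces_orderComplex.1 hs
    obtain ⟨h0, h1, hxc⟩ := mem_convexHull_image_single.1 hx
    exact ⟨h0, h1, fun a b ha hb => ⟨hcP a (hxc a ha), hc.total (hxc a ha) (hxc b hb)⟩⟩
  · rintro ⟨h0, h1, hx⟩
    refine ⟨_, mem_faces_orderComplex.2 ⟨univ.filter fun a => x a ≠ 0, ⟨?_, ?_, ?_⟩, rfl⟩,
      mem_convexHull_image_single.2 ⟨h0, h1, fun a ha => by simpa using ha⟩⟩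
    · by_contra hne
      rw [Finset.not_nonempty_iff_eq_empty, Finset.filter_eq_empty_iff] at hne
      have : ∑ a, x a = 0 := Finset.sum_eq_zero fun a ha => by simpa using hne ha
      linarith
    · intro a ha
      have ha : x a ≠ 0 := by simpa using ha
      exact (hx a a ha ha).1
    · intro a ha b hb _
      exact (hx a b (by simpa using ha) (by simpa using hb)).2

lemma space_orderComplex_mono (h : P ⊆ Q) : (orderComplex P).space ⊆ (orderComplex Q).space := by
  intro x hx
  obtain ⟨h0, h1, hx⟩ := mem_space_orderComplex.1 hx
  exact mem_space_orderComplex.2 ⟨h0, h1, fun a b ha hb => ⟨h (hx a b ha hb).1, (hx a b ha hb).2⟩⟩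

/-- Deleting `Δ(P)` from `Δ(Q)` leaves the order complex of `Q \ P`. -/
lemma deletion_orderComplex :
    deletion (orderComplex Q) (orderComplex P) = orderComplex (Q \ P) := by
  ext s
  constructor
  · rintro ⟨hs, hsub⟩
    obtain ⟨c, ⟨hne, hcQ, hc⟩, rfl⟩ := mem_faces_orderComplex.1 hs
    refine mem_faces_orderComplex.2 ⟨c, ⟨hne, fun a ha => ⟨hcQ a ha, fun haP => ?_⟩, hc⟩, rfl⟩
    have hmem : (Pi.single a (1 : ℝ) : α → ℝ) ∈ (orderComplex P).space := by
      refine (orderComplex P).convexHull_subset_space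
        (mem_faces_orderComplex.2 ⟨{a}, ⟨by simp, by simpa using haP, by simp⟩, rfl⟩)
        (subset_convexHull ℝ _ (by simp))
    exact (hsub (subset_convexHull ℝ _ (Finset.mem_coe.2 (Finset.mem_image_of_mem _ ha)))).2 hmem
  · intro hs
    obtain ⟨c, ⟨hne, hcQ, hc⟩, rfl⟩ := mem_faces_orderComplex.1 hs
    have hs' : c.image (fun a => (Pi.single a (1 : ℝ) : α → ℝ)) ∈ (orderComplex Q).faces :=
      mem_faces_orderComplex.2 ⟨c, ⟨hne, fun a ha => (hcQ a ha).1, hc⟩, rfl⟩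
    refine ⟨hs', fun x hx =>
      ⟨(orderComplex Q).convexHull_subset_space hs' hx, fun hxP => ?_⟩⟩
    obtain ⟨h0, h1, hxc⟩ := mem_convexHull_image_single.1 hx
    obtain ⟨-, -, hP⟩ := mem_space_orderComplex.1 hxP
    obtain ⟨a, ha⟩ : ∃ a, x a ≠ 0 := by
      by_contra! h
      simp [h] at h1
    exact (hcQ a (hxc a ha)).2 (hP a a ha ha).1

/-- The weights `w` on the vertices `v` describe a point of `|Δ(P)|`. -/
structure Admissible {ι : Type*} [Fintype ι] (P : Set α) (v : ι → α) (w : ι → ℝ) : Prop where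
  nonneg : ∀ i, 0 ≤ w i
  exists_pos : ∃ i, 0 < w i
  chain : ∀ i j, 0 < w i → 0 < w j → v i ∈ P ∧ (v i ≤ v j ∨ v j ≤ v i)

variable {ι : Type*} [Fintype ι] {v : ι → α} {w : ι → ℝ}

lemma Admissible.mem_space (h : Admissible P v w) :
    weightedPoint v w ∈ (orderComplex P).space := by
  have hpos := sum_pos_of_exists h.nonneg h.exists_pos
  refine mem_space_orderComplex.2 ⟨fun a => ?_, ?_, fun a b ha hb => ?_⟩
  · refine mul_nonneg (inv_nonneg.2 hpos.le) (Finset.sum_nonneg fun i _ => ?_)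
    split_ifs
    exacts [h.nonneg i, le_rfl]
  · simp only [weightedPoint]
    rw [← Finset.mul_sum, Finset.sum_comm]
    simp only [Finset.sum_ite_eq, Finset.mem_univ, if_true]
    exact inv_mul_cancel₀ hpos.ne'
  · obtain ⟨i, rfl, hi⟩ := exists_of_weightedPoint_ne_zero h.nonneg ha
    obtain ⟨j, rfl, hj⟩ := exists_of_weightedPoint_ne_zero h.nonneg hb
    exact h.chain i j hi hj

/-- A continuous family of admissible weights defines a continuous map into `|Δ(P)|`. -/
noncomputable def weightedMap {Y : Type*} [TopologicalSpace Y] (v : ι → α) (w : Y → ι → ℝ)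
    (hw : ∀ i, Continuous fun y => w y i) (h : ∀ y, Admissible P v (w y)) :
    C(Y, (orderComplex P).space) where
  toFun y := ⟨weightedPoint v (w y), (h y).mem_space⟩
  continuous_toFun := (continuous_weightedPoint hw fun y =>
    sum_pos_of_exists (h y).nonneg (h y).exists_pos).subtype_mk _

lemma homotopic_of_map {X Y : Type*} [TopologicalSpace X] [TopologicalSpace Y] {f g : C(X, Y)}
    (F : C(unitInterval × X, Y)) (h0 : ∀ x, F (0, x) = f x) (h1 : ∀ x, F (1, x) = g x) :
    f.Homotopic g :=
  ⟨{ toContinuousMap := F, map_zero_left := h0, map_one_left := h1 }⟩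

/-- The complement of `|Δ(P)|` in `|Δ(Q)|` deformation retracts to `|Δ(Q \ P)|`. -/
theorem nonempty_homotopyEquiv_complement (P Q : Set α) :
    Nonempty (ContinuousMap.HomotopyEquiv
      (((orderComplex Q).space \ (orderComplex P).space : Set (α → ℝ)))
      ((orderComplex (Q \ P)).space)) := by
  classical
  have hout : ∀ x ∈ (orderComplex Q).space \ (orderComplex P).space, ∃ a, a ∉ P ∧ 0 < x a := by
    rintro x ⟨hxQ, hxP⟩
    obtain ⟨h0, h1, hx⟩ := mem_space_orderComplex.1 hxQ
    by_contra! h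
    refine hxP (mem_space_orderComplex.2 ⟨h0, h1, fun a b ha hb => ⟨?_, (hx a b ha hb).2⟩⟩)
    by_contra haP
    exact ha (le_antisymm (h a haP) (h0 a))
  have hin : (orderComplex (Q \ P)).space ⊆ (orderComplex Q).space \ (orderComplex P).space := by
    intro x hx
    refine ⟨space_orderComplex_mono Set.sdiff_subset hx, fun hxP => ?_⟩
    obtain ⟨h0, h1, hQ⟩ := mem_space_orderComplex.1 hx
    obtain ⟨-, -, hP⟩ := mem_space_orderComplex.1 hxP
    obtain ⟨a, ha⟩ : ∃ a, x a ≠ 0 := by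
      by_contra! h
      simp [h] at h1
    exact (hQ a a ha ha).1.2 (hP a a ha ha).1
  let Y := (((orderComplex Q).space \ (orderComplex P).space : Set (α → ℝ)))
  -- At `1` this is the identity, at `0` the `P`-coordinates are gone. A positive coordinate outside
  -- `P` is never scaled, so the total stays positive and the path avoids `|Δ(P)|`.
  let w : unitInterval × Y → α → ℝ := fun p a => if a ∈ P then (p.1 : ℝ) * p.2.1 a else p.2.1 a
  have hwc : ∀ a, Continuous fun p => w p a := by
    intro a
    have hx : Continuous fun p : unitInterval × Y => p.2.1 a :=
      (continuous_apply a).comp (continuous_subtype_val.comp continuous_snd)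
    simp only [w]
    split_ifs
    exacts [(continuous_subtype_val.comp continuous_fst).mul hx, hx]
  have hx0 : ∀ (x : Y) a, 0 ≤ x.1 a := fun x => (mem_space_orderComplex.1 x.2.1).1
  have hw0 : ∀ p a, 0 ≤ w p a := by
    intro p a
    have := hx0 p.2 a
    have := p.1.2.1
    simp only [w]
    split_ifs <;> positivity
  have hwpos : ∀ p a, 0 < w p a → p.2.1 a ≠ 0 := by
    intro p a ha h
    simp [w, h] at ha
  have hwout : ∀ p, ∃ a, a ∉ P ∧ 0 < w p a := by
    intro p
    obtain ⟨a, haP, ha⟩ := hout p.2.1 p.2.2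
    exact ⟨a, haP, by simpa [w, haP] using ha⟩
  have hadm : ∀ p, Admissible Q id (w p) := fun p =>
    ⟨hw0 p, (hwout p).imp fun a h => h.2, fun a b ha hb =>
      (mem_space_orderComplex.1 p.2.2.1).2.2 a b (hwpos p a ha) (hwpos p b hb)⟩
  have hadm0 : ∀ x : Y, Admissible (Q \ P) id (w (0, x)) := by
    refine fun x => ⟨hw0 _, (hadm (0, x)).exists_pos, fun a b ha hb => ⟨⟨?_, fun haP => ?_⟩, ?_⟩⟩
    · exact ((hadm (0, x)).chain a b ha hb).1
    · change a ∈ P at haP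
      simp [w, haP] at ha
    · exact ((hadm (0, x)).chain a b ha hb).2
  let ρ : C(Y, (orderComplex (Q \ P)).space) :=
    weightedMap id (fun x => w (0, x)) (fun a => (hwc a).comp (by fun_prop)) hadm0
  let i : C((orderComplex (Q \ P)).space, Y) := ⟨Set.inclusion hin, continuous_inclusion hin⟩
  let F : C(unitInterval × Y, Y) :=
    { toFun := fun p => ⟨weightedPoint id (w p), (hadm p).mem_space, fun h => by
        obtain ⟨a, haP, ha⟩ := hwout p
        have hne : weightedPoint id (w p) a ≠ 0 := (weightedPoint_pos (v := id) (hw0 p) ha).ne'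
        exact haP ((mem_space_orderComplex.1 h).2.2 a a hne hne).1⟩
      continuous_toFun := (continuous_weightedPoint hwc fun p =>
        sum_pos_of_exists (hw0 p) (hadm p).exists_pos).subtype_mk _ }
  refine ⟨⟨ρ, i, homotopic_of_map F (fun x => rfl) fun x => Subtype.ext ?_, ?_⟩⟩
  · have : w (1, x) = x.1 := by
      ext a
      simp [w]
    change weightedPoint id (w (1, x)) = x.1
    rw [this, weightedPoint_id (mem_space_orderComplex.1 x.2.1).2.1]
  · have : ρ.comp i = ContinuousMap.id _ := by
      ext1 x
      refine Subtype.ext ?_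
      obtain ⟨h0, h1, hx⟩ := mem_space_orderComplex.1 x.2
      have hw : w (0, i x) = x.1 := by
        ext a
        simp only [w, i]
        split_ifs with haP
        · have : x.1 a = 0 := by_contra fun h => (hx a a h h).1.2 haP
          simp [this]
        · rfl
      change weightedPoint id (w (0, i x)) = x.1
      rw [hw, weightedPoint_id h1]
    rw [this]

end Realization

/-! ### Continuous weights on superlevel sets, in place of barycentric subdivision. -/

section LevelWeights

lemma pos_of_mem_support {α : Type*} [Fintype α] {x : α → ℝ} (hx : ∀ a, 0 ≤ x a)
    {a : α} (ha : a ∈ univ.filter fun a => x a ≠ 0) : 0 < x a :=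
  lt_of_le_of_ne (hx a) (Ne.symm (by simpa using ha))

variable {α : Type*} [Fintype α] [DecidableEq α]

/-- For nonnegative `x`, this is positive exactly when `c` is a nonempty strict superlevel set of
`x` contained in its support. -/
noncomputable def levelWeight (x : α → ℝ) (c : Finset α) : ℝ :=
  (c.card : ℝ) * (∏ a ∈ c, x a) * ∏ a ∈ c, ∏ b ∈ cᶜ, max 0 (x a - x b)

/-- A variant of `levelWeight` that keeps only the levels up to the threshold `t`. -/
noncomputable def lowWeight (t : ℝ) (x : α → ℝ) (c : Finset α) : ℝ :=
  t * levelWeight x c * ∏ b ∈ cᶜ, max 0 (t - x b)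

/-- A variant of `levelWeight` that keeps only the levels from the threshold `t` on. -/
noncomputable def highWeight (t : ℝ) (x : α → ℝ) (c : Finset α) : ℝ :=
  (1 - t) * levelWeight x c * ∏ a ∈ c, max 0 (x a - t)

variable {x : α → ℝ} {c d : Finset α} {t : ℝ}

lemma levelWeight_nonneg (hx : ∀ a, 0 ≤ x a) : 0 ≤ levelWeight x c := by
  refine mul_nonneg (mul_nonneg (Nat.cast_nonneg _) (prod_nonneg fun a _ => hx a)) ?_
  exact prod_nonneg fun a _ => prod_nonneg fun b _ => le_max_left _ _

lemma lowWeight_nonneg (hx : ∀ a, 0 ≤ x a) (ht : 0 ≤ t) : 0 ≤ lowWeight t x c :=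
  mul_nonneg (mul_nonneg ht (levelWeight_nonneg hx)) (prod_nonneg fun _ _ => le_max_left _ _)

lemma highWeight_nonneg (hx : ∀ a, 0 ≤ x a) (ht : t ≤ 1) : 0 ≤ highWeight t x c :=
  mul_nonneg (mul_nonneg (sub_nonneg.2 ht) (levelWeight_nonneg hx))
    (prod_nonneg fun _ _ => le_max_left _ _)

/-- The cardinality factor rules out `c = ∅`, for which both products are empty and equal to `1`. -/
lemma of_levelWeight_ne_zero (h : levelWeight x c ≠ 0) :
    c.Nonempty ∧ (∀ a ∈ c, x a ≠ 0) ∧ ∀ a ∈ c, ∀ b ∉ c, x b < x a := by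
  obtain ⟨⟨h1, h2⟩, h3⟩ : ((c.card : ℝ) ≠ 0 ∧ ∏ a ∈ c, x a ≠ 0) ∧
      ∏ a ∈ c, ∏ b ∈ cᶜ, max 0 (x a - x b) ≠ 0 := by
    simpa only [levelWeight, mul_ne_zero_iff] using h
  refine ⟨card_ne_zero.1 (Nat.cast_ne_zero.1 h1), prod_ne_zero_iff.1 h2, fun a ha b hb => ?_⟩
  have := prod_ne_zero_iff.1 (prod_ne_zero_iff.1 h3 a ha) b (mem_compl.2 hb)
  by_contra hle
  exact this (max_eq_left (by linarith))

lemma of_lowWeight_ne_zero (h : lowWeight t x c ≠ 0) :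
    levelWeight x c ≠ 0 ∧ ∀ b ∉ c, x b < t := by
  obtain ⟨⟨-, h2⟩, h3⟩ : (t ≠ 0 ∧ levelWeight x c ≠ 0) ∧ ∏ b ∈ cᶜ, max 0 (t - x b) ≠ 0 := by
    simpa only [lowWeight, mul_ne_zero_iff] using h
  refine ⟨h2, fun b hb => ?_⟩
  have := prod_ne_zero_iff.1 h3 b (mem_compl.2 hb)
  by_contra hle
  exact this (max_eq_left (by linarith))

lemma of_highWeight_ne_zero (h : highWeight t x c ≠ 0) :
    levelWeight x c ≠ 0 ∧ ∀ a ∈ c, t < x a := by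
  obtain ⟨⟨-, h2⟩, h3⟩ : (1 - t ≠ 0 ∧ levelWeight x c ≠ 0) ∧ ∏ a ∈ c, max 0 (x a - t) ≠ 0 := by
    simpa only [highWeight, mul_ne_zero_iff] using h
  refine ⟨h2, fun a ha => ?_⟩
  have := prod_ne_zero_iff.1 h3 a ha
  by_contra hle
  exact this (max_eq_left (by linarith))

lemma subset_or_subset_of_levelWeight_ne_zero (hc : levelWeight x c ≠ 0)
    (hd : levelWeight x d ≠ 0) : c ⊆ d ∨ d ⊆ c := by
  by_contra! h
  obtain ⟨a, hac, had⟩ := Finset.not_subset.1 h.1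
  obtain ⟨b, hbd, hbc⟩ := Finset.not_subset.1 h.2
  have h1 := (of_levelWeight_ne_zero hc).2.2 a hac b hbc
  have h2 := (of_levelWeight_ne_zero hd).2.2 b hbd a had
  linarith

/-- Elements of `c` lie above the threshold, elements outside `d` below it. -/
lemma subset_of_highWeight_ne_zero_of_lowWeight_ne_zero (hc : highWeight t x c ≠ 0)
    (hd : lowWeight t x d ≠ 0) : c ⊆ d := by
  intro a ha
  by_contra had
  exact lt_asymm ((of_highWeight_ne_zero hc).2 a ha) ((of_lowWeight_ne_zero hd).2 a had)

section Support

variable (hx : ∀ a, 0 ≤ x a) (hne : ∃ a, x a ≠ 0)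
include hx hne

/-- The support is always a strict superlevel set; it supplies the positive weight that
normalisation needs. -/
lemma levelWeight_support_pos : 0 < levelWeight x (univ.filter fun a => x a ≠ 0) := by
  refine mul_pos (mul_pos (Nat.cast_pos.2 (card_pos.2 ?_)) ?_) ?_
  · exact hne.imp fun a ha => by simpa using ha
  · exact prod_pos fun a ha => pos_of_mem_support hx ha
  · refine prod_pos fun a ha => prod_pos fun b hb => lt_max_of_lt_right ?_
    have hb : x b = 0 := by simpa using hb
    rw [hb, sub_zero]
    exact pos_of_mem_support hx ha

lemma lowWeight_support_pos (ht : 0 < t) : 0 < lowWeight t x (univ.filter fun a => x a ≠ 0) := by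
  refine mul_pos (mul_pos ht (levelWeight_support_pos hx hne))
    (prod_pos fun b hb => lt_max_of_lt_right ?_)
  have hb : x b = 0 := by simpa using hb
  rwa [hb, sub_zero]

lemma highWeight_support_pos : 0 < highWeight 0 x (univ.filter fun a => x a ≠ 0) := by
  refine mul_pos (mul_pos (by norm_num) (levelWeight_support_pos hx hne))
    (prod_pos fun a ha => lt_max_of_lt_right ?_)
  rw [sub_zero]
  exact pos_of_mem_support hx ha

end Support

/-- The leading factor `t` is needed for `c = univ`, where the product over the complement is empty.
-/
lemma lowWeight_zero : lowWeight (0 : ℝ) x = 0 := by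
  ext c
  simp [lowWeight]

lemma highWeight_one : highWeight (1 : ℝ) x = 0 := by
  ext c
  simp [highWeight]

section Continuity

variable {Y : Type*} [TopologicalSpace Y] {f : Y → α → ℝ} {s : Y → ℝ}

lemma continuous_levelWeight (hf : ∀ a, Continuous fun y => f y a) (c : Finset α) :
    Continuous fun y => levelWeight (f y) c :=
  (continuous_const.mul (continuous_finsetProd _ fun a _ => hf a)).mul
    (continuous_finsetProd _ fun a _ => continuous_finsetProd _ fun b _ =>
      continuous_const.max ((hf a).sub (hf b)))

lemma continuous_lowWeight (hs : Continuous s) (hf : ∀ a, Continuous fun y => f y a)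
    (c : Finset α) : Continuous fun y => lowWeight (s y) (f y) c :=
  (hs.mul (continuous_levelWeight hf c)).mul
    (continuous_finsetProd _ fun b _ => continuous_const.max (hs.sub (hf b)))

lemma continuous_highWeight (hs : Continuous s) (hf : ∀ a, Continuous fun y => f y a)
    (c : Finset α) : Continuous fun y => highWeight (s y) (f y) c :=
  ((continuous_const.sub hs).mul (continuous_levelWeight hf c)).mul
    (continuous_finsetProd _ fun a _ => continuous_const.max ((hf a).sub hs))

end Continuity

end LevelWeights

section OrderComplexPoint

variable {α : Type*} [PartialOrder α] [Fintype α] [DecidableEq α] {P : Set α} {x : α → ℝ}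

lemma exists_ne_zero_of_mem_space (hx : x ∈ (orderComplex P).space) :
    ∃ a, x a ≠ 0 := by
  obtain ⟨-, h1, -⟩ := mem_space_orderComplex.1 hx
  by_contra! h
  simp [h] at h1

lemma isChain_of_levelWeight_ne_zero (hx : x ∈ (orderComplex P).space) {c : Finset α}
    (hc : levelWeight x c ≠ 0) :
    c.Nonempty ∧ (∀ a ∈ c, a ∈ P) ∧ IsChain (· ≤ ·) (c : Set α) := by
  obtain ⟨-, -, hxP⟩ := mem_space_orderComplex.1 hx
  obtain ⟨h1, h2, -⟩ := of_levelWeight_ne_zero hc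
  exact ⟨h1, fun a ha => (hxP a a (h2 a ha) (h2 a ha)).1,
    fun a ha b hb _ => (hxP a b (h2 a ha) (h2 b hb)).2⟩

end OrderComplexPoint

/-! ### Antitone maps on chains and the homotopy equivalences they induce. -/

section ChainMap

variable {α : Type*} [SemilatticeInf α] [OrderTop α] {P Q : Set α}

lemma inf_id_mem_of_isChain {c : Finset α} (hne : c.Nonempty) (hc : IsChain (· ≤ ·) (c : Set α)) :
    c.inf id ∈ c := by
  obtain ⟨a, ha, hmin⟩ := c.exists_minimal hne
  have : c.inf id = a := le_antisymm (Finset.inf_le ha) <| Finset.le_inf fun b hb =>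
    (hc.total ha hb).elim id fun h => hmin hb h
  exact this ▸ ha

/-- `q` sends nonempty chains of `Q` antitonely to upper bounds of their minima that lie
in `P`. -/
structure IsChainMap (Q P : Set α) (q : Finset α → α) : Prop where
  antitone : ∀ c d, c ⊆ d → q d ≤ q c
  inf_le : ∀ c : Finset α, c.Nonempty → (∀ a ∈ c, a ∈ Q) → IsChain (· ≤ ·) (c : Set α) →
    c.inf id ≤ q c
  mem : ∀ c : Finset α, c.Nonempty → (∀ a ∈ c, a ∈ Q) → IsChain (· ≤ ·) (c : Set α) → q c ∈ P

lemma IsChainMap.mono {P' Q' : Set α} {q : Finset α → α} (hq : IsChainMap Q P q) (hQ : Q' ⊆ Q)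
    (hP : P ⊆ P') : IsChainMap Q' P' q :=
  ⟨hq.antitone, fun c h1 h2 h3 => hq.inf_le c h1 (fun a ha => hQ (h2 a ha)) h3,
    fun c h1 h2 h3 => hP (hq.mem c h1 (fun a ha => hQ (h2 a ha)) h3)⟩

end ChainMap

section InfRetraction

variable {α : Type*} [SemilatticeInf α] [OrderTop α] [Fintype α] [DecidableEq α] {P Q : Set α}

variable {q : Finset α → α}

lemma IsChainMap.admissible_highWeight (hq : IsChainMap Q P q) {x : α → ℝ}
    (hx : x ∈ (orderComplex Q).space) : Admissible P q (highWeight 0 x) := by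
  have h0 := (mem_space_orderComplex.1 hx).1
  refine ⟨fun c => highWeight_nonneg h0 zero_le_one,
    ⟨_, highWeight_support_pos h0 (exists_ne_zero_of_mem_space hx)⟩, fun c d hc hd => ?_⟩
  have hc := (of_highWeight_ne_zero hc.ne').1
  have hd := (of_highWeight_ne_zero hd.ne').1
  obtain ⟨h1, h2, h3⟩ := isChain_of_levelWeight_ne_zero hx hc
  refine ⟨hq.mem c h1 h2 h3, ?_⟩
  exact (subset_or_subset_of_levelWeight_ne_zero hc hd).symm.imp (hq.antitone _ _)
    (hq.antitone _ _)

/-- Superlevel sets are nested and both vertex maps are antitone, so each family alone gives a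
chain. Across families, a high set `d` lies in a low set `c`, whence `c.inf id ≤ d.inf id ≤ q d`. -/
lemma IsChainMap.admissible_low_high (hq : IsChainMap Q Q q) {x : α → ℝ}
    (hx : x ∈ (orderComplex Q).space) (t : unitInterval) :
    Admissible Q (Sum.elim (fun c : Finset α => c.inf id) q)
      (Sum.elim (lowWeight (t : ℝ) x) (highWeight (t : ℝ) x)) := by
  have h0 := (mem_space_orderComplex.1 hx).1
  have hlow : ∀ c, lowWeight (t : ℝ) x c ≠ 0 → levelWeight x c ≠ 0 :=
    fun c hc => (of_lowWeight_ne_zero hc).1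
  have hhigh : ∀ c, highWeight (t : ℝ) x c ≠ 0 → levelWeight x c ≠ 0 :=
    fun c hc => (of_highWeight_ne_zero hc).1
  have hinf : ∀ c, levelWeight x c ≠ 0 → c.inf id ∈ Q := fun c hc => by
    obtain ⟨h1, h2, h3⟩ := isChain_of_levelWeight_ne_zero hx hc
    exact h2 _ (inf_id_mem_of_isChain h1 h3)
  have hmem : ∀ c, levelWeight x c ≠ 0 → q c ∈ Q := fun c hc => by
    obtain ⟨h1, h2, h3⟩ := isChain_of_levelWeight_ne_zero hx hc
    exact hq.mem c h1 h2 h3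
  have hmix : ∀ c d, lowWeight (t : ℝ) x c ≠ 0 → highWeight (t : ℝ) x d ≠ 0 →
      c.inf id ≤ q d := fun c d hc hd => by
    obtain ⟨h1, h2, h3⟩ := isChain_of_levelWeight_ne_zero hx (hhigh d hd)
    exact (Finset.inf_mono (subset_of_highWeight_ne_zero_of_lowWeight_ne_zero hd hc)).trans
      (hq.inf_le d h1 h2 h3)
  refine ⟨?_, ?_, ?_⟩
  · rintro (c | c)
    · exact lowWeight_nonneg h0 t.2.1
    · exact highWeight_nonneg h0 t.2.2
  · rcases t.2.1.eq_or_lt with ht | ht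
    · refine ⟨Sum.inr (univ.filter fun a => x a ≠ 0), ?_⟩
      rw [← ht]
      exact highWeight_support_pos h0 (exists_ne_zero_of_mem_space hx)
    · exact ⟨Sum.inl _, lowWeight_support_pos h0 (exists_ne_zero_of_mem_space hx) ht⟩
  · rintro (c | c) (d | d) hc hd
    · exact ⟨hinf c (hlow c hc.ne'), (subset_or_subset_of_levelWeight_ne_zero (hlow c hc.ne')
        (hlow d hd.ne')).symm.imp (fun h => Finset.inf_mono h) (fun h => Finset.inf_mono h)⟩
    · exact ⟨hinf c (hlow c hc.ne'), Or.inl (hmix c d hc.ne' hd.ne')⟩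
    · exact ⟨hmem c (hhigh c hc.ne'), Or.inr (hmix d c hd.ne' hc.ne')⟩
    · exact ⟨hmem c (hhigh c hc.ne'), (subset_or_subset_of_levelWeight_ne_zero (hhigh c hc.ne')
        (hhigh d hd.ne')).symm.imp (hq.antitone _ _) (hq.antitone _ _)⟩

/-- The minimum of a superlevel set is itself a vertex in the support of `x`, so the straight line
stays in one simplex. -/
lemma admissible_id_low {x : α → ℝ} (hx : x ∈ (orderComplex Q).space) (t : unitInterval) :
    Admissible Q (Sum.elim (fun c : Finset α => c.inf id) id)
      (Sum.elim (fun c => (1 - (t : ℝ)) * lowWeight 1 x c) fun a => (t : ℝ) * x a) := by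
  obtain ⟨h0, -, hQ⟩ := mem_space_orderComplex.1 hx
  have ht1 : 0 ≤ 1 - (t : ℝ) := sub_nonneg.2 t.2.2
  have hinf : ∀ c, 0 < (1 - (t : ℝ)) * lowWeight 1 x c → x (c.inf id) ≠ 0 := fun c hc => by
    have hl := (of_lowWeight_ne_zero (right_ne_zero_of_mul hc.ne')).1
    obtain ⟨h1, h2, h3⟩ := isChain_of_levelWeight_ne_zero hx hl
    exact (of_levelWeight_ne_zero hl).2.1 _ (inf_id_mem_of_isChain h1 h3)
  refine ⟨?_, ?_, ?_⟩
  · rintro (c | a)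
    · exact mul_nonneg ht1 (lowWeight_nonneg h0 zero_le_one)
    · exact mul_nonneg t.2.1 (h0 a)
  · rcases t.2.1.eq_or_lt with ht | ht
    · refine ⟨Sum.inl _, mul_pos ?_ (lowWeight_support_pos h0 (exists_ne_zero_of_mem_space hx)
        zero_lt_one)⟩
      rw [← ht]
      norm_num
    · obtain ⟨a, ha⟩ := exists_ne_zero_of_mem_space hx
      exact ⟨Sum.inr a, mul_pos ht (lt_of_le_of_ne (h0 a) ha.symm)⟩
  · rintro (c | a) (d | b) hc hd
    · exact hQ _ _ (hinf c hc) (hinf d hd)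
    · exact hQ _ _ (hinf c hc) (right_ne_zero_of_mul hd.ne')
    · exact hQ _ _ (right_ne_zero_of_mul hc.ne') (hinf d hd)
    · exact hQ _ _ (right_ne_zero_of_mul hc.ne') (right_ne_zero_of_mul hd.ne')

/-- The map `|Δ(Q)| → |Δ(P)|` that is induced by `q` on the superlevel sets of a point. -/
noncomputable def IsChainMap.realization (hq : IsChainMap Q P q) :
    C((orderComplex Q).space, (orderComplex P).space) :=
  weightedMap q (fun x => highWeight 0 x.1)
    (continuous_highWeight continuous_const fun a =>
      (continuous_apply a).comp continuous_subtype_val) fun x => hq.admissible_highWeight x.2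

/-- Raising the threshold from `0` to `1` trades the vertices `q c` for the minima `c.inf id` (the
homotopy `F`). The resulting map `m` is then joined to the identity by the straight-line homotopy
`G`, up to normalisation. -/
theorem IsChainMap.realization_homotopic_id (hq : IsChainMap Q Q q) :
    hq.realization.Homotopic (ContinuousMap.id _) := by
  have hx : ∀ a, Continuous fun p : unitInterval × (orderComplex Q).space => p.2.1 a := fun a =>
    (continuous_apply a).comp (continuous_subtype_val.comp continuous_snd)
  have ht : Continuous fun p : unitInterval × (orderComplex Q).space => (p.1 : ℝ) :=
    continuous_subtype_val.comp continuous_fst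
  let F : C(unitInterval × (orderComplex Q).space, (orderComplex Q).space) :=
    weightedMap _ (fun p => Sum.elim (lowWeight (p.1 : ℝ) p.2.1) (highWeight (p.1 : ℝ) p.2.1))
      (by
        rintro (c | c)
        exacts [continuous_lowWeight ht hx c, continuous_highWeight ht hx c])
      fun p => hq.admissible_low_high p.2.2 p.1
  let G : C(unitInterval × (orderComplex Q).space, (orderComplex Q).space) :=
    weightedMap _ (fun p => Sum.elim (fun c => (1 - (p.1 : ℝ)) * lowWeight 1 p.2.1 c)
        fun a => (p.1 : ℝ) * p.2.1 a)
      (by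
        rintro (c | a)
        exacts [(continuous_const.sub ht).mul (continuous_lowWeight continuous_const hx c),
          ht.mul (hx a)])
      fun p => admissible_id_low p.2.2 p.1
  let m : C((orderComplex Q).space, (orderComplex Q).space) := F.comp (.prodMk (.const _ 1) (.id _))
  have hm : ∀ x, (m x).1 = weightedPoint (fun c : Finset α => c.inf id) (lowWeight 1 x.1) := by
    intro x
    change weightedPoint _ (Sum.elim (lowWeight (1 : ℝ) x.1) (highWeight (1 : ℝ) x.1)) = _
    rw [highWeight_one, weightedPoint_sumElim_zero_right]
  refine (homotopic_of_map (g := m) F (fun x => Subtype.ext ?_) fun x => rfl).trans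
    (homotopic_of_map G (fun x => Subtype.ext ?_) fun x => Subtype.ext ?_)
  · change weightedPoint _ (Sum.elim (lowWeight (0 : ℝ) x.1) (highWeight (0 : ℝ) x.1)) =
      weightedPoint q (highWeight 0 x.1)
    rw [lowWeight_zero, weightedPoint_sumElim_zero_left]
  · rw [hm]
    change weightedPoint _ (Sum.elim (fun c => (1 - (0 : ℝ)) * lowWeight 1 x.1 c)
      fun a => (0 : ℝ) * x.1 a) = _
    rw [show (fun c => (1 - (0 : ℝ)) * lowWeight 1 x.1 c) = lowWeight 1 x.1 by simp,
      show (fun a => (0 : ℝ) * x.1 a) = 0 by ext a; simp, weightedPoint_sumElim_zero_right]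
  · change weightedPoint _ (Sum.elim (fun c => (1 - (1 : ℝ)) * lowWeight 1 x.1 c)
      fun a => (1 : ℝ) * x.1 a) = x.1
    rw [show (fun c => (1 - (1 : ℝ)) * lowWeight 1 x.1 c) = 0 by ext c; simp,
      show (fun a => (1 : ℝ) * x.1 a) = x.1 by simp, weightedPoint_sumElim_zero_left,
      weightedPoint_id (mem_space_orderComplex.1 x.2).2.1]

/-- If nonempty chains of `Q` can be sent antitonely to elements of `P ⊆ Q` above their minima,
then `|Δ(Q)|` and `|Δ(P)|` are homotopy equivalent. -/
theorem IsChainMap.nonempty_homotopyEquiv (hq : IsChainMap Q P q) (hPQ : P ⊆ Q) :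
    Nonempty (ContinuousMap.HomotopyEquiv (orderComplex Q).space (orderComplex P).space) :=
  ⟨⟨hq.realization, ⟨Set.inclusion (space_orderComplex_mono hPQ), continuous_inclusion _⟩,
    -- Both composites with the inclusion are realizations of the same `q`, read as a chain map on
    -- `Q` and on `P`.
    (hq.mono subset_rfl hPQ).realization_homotopic_id,
    (hq.mono hPQ subset_rfl).realization_homotopic_id⟩⟩

end InfRetraction

/-! ### Non-flats, spanning sets and the dimension bound. -/

section Matroid

variable {n : ℕ} {M : Matroid (Fin n)}

lemma mem_properBoolean_diff_nonSpanning (hE : M.E = Set.univ) {s : Finset (Fin n)} :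
    s ∈ properBoolean n \ nonSpanning M ↔
      s ∈ properBoolean n ∧ M.Spanning (s : Set (Fin n)) := by
  have hs : (s : Set (Fin n)) ⊆ M.E := hE ▸ Set.subset_univ _
  rw [Matroid.spanning_iff_eRk_le hs]
  constructor
  · rintro ⟨h1, h2⟩
    exact ⟨h1, not_lt.1 fun h => h2 ⟨h1, h⟩⟩
  · rintro ⟨h1, h2⟩
    exact ⟨h1, fun h => not_lt.2 h2 h.2⟩

/-- A spanning flat equals its closure, which is the whole ground set. -/
lemma properBoolean_diff_nonSpanning_subset (hE : M.E = Set.univ) :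
    properBoolean n \ nonSpanning M ⊆ properBoolean n \ properFlats M := by
  intro s hs
  obtain ⟨h1, h2⟩ := (mem_properBoolean_diff_nonSpanning hE).1 hs
  refine ⟨h1, fun h => h1.2 (Finset.coe_eq_univ.1 ?_)⟩
  rw [← h.2.closure, h2.closure_eq, hE]

lemma exists_mem_closure_notMem (hE : M.E = Set.univ) {s : Finset (Fin n)}
    (hs : s ∈ properBoolean n \ properFlats M) : ∃ a ∈ M.closure s, a ∉ s := by
  by_contra! h
  refine hs.2 ⟨hs.1, Matroid.isFlat_iff_closure_eq.2 (Set.Subset.antisymm h ?_)⟩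
  exact M.subset_closure _ (hE ▸ Set.subset_univ _)

/-- Removing from the ground set one point `a s ∈ cl s \ s` for every member `s` of a chain leaves
a spanning set. -/
lemma spanning_compl_image_of_isChain (hE : M.E = Set.univ) {a : Finset (Fin n) → Fin n}
    (c : Finset (Finset (Fin n))) (ha : ∀ s ∈ c, a s ∈ M.closure s ∧ a s ∉ s)
    (hc : IsChain (· ≤ ·) (c : Set (Finset (Fin n)))) :
    M.Spanning ((c.image a)ᶜ : Finset (Fin n)) := by
  induction c using Finset.strongInduction with
  | H c ih =>
    rcases c.eq_empty_or_nonempty with rfl | hne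
    · have : ((∅ : Finset (Finset (Fin n))).image a)ᶜ = univ := by simp
      rw [this, Finset.coe_univ, ← hE]
      exact M.ground_spanning
    obtain ⟨s, hs, hmin⟩ := c.exists_minimal hne
    have hle : ∀ t ∈ c, s ≤ t := fun t ht => (hc.total hs ht).elim id fun h => hmin ht h
    have hsp := ih (c.erase s) (Finset.erase_ssubset hs)
      (fun t ht => ha t (Finset.mem_of_mem_erase ht))
      (hc.mono (Finset.coe_subset.2 (Finset.erase_subset s c)))
    -- The minimum `s` lies in every `t ∈ c`, and `a t ∉ t`, so no removed point is in `s`.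
    have hsub : (s : Set (Fin n)) ⊆ ((c.image a)ᶜ : Finset (Fin n)) := by
      intro b hb
      simp only [Finset.coe_compl, Set.mem_compl_iff, Finset.mem_coe, Finset.mem_image, not_exists,
        not_and]
      rintro t ht rfl
      exact (ha t ht).2 (hle t ht hb)
    -- By induction the points left after omitting `s` from the chain span. The only one possibly
    -- lost is `a s`, recovered from `a s ∈ cl s` and `hsub`.
    rw [Matroid.spanning_iff_ground_subset_closure (hE ▸ Set.subset_univ _), ← hsp.closure_eq]
    refine M.closure_subset_closure_of_subset_closure fun b hb => ?_
    by_cases hbs : b = a s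
    · subst hbs
      exact M.closure_subset_closure hsub (ha s hs).1
    · refine M.subset_closure _ (hE ▸ Set.subset_univ _) ?_
      simp only [Finset.coe_compl, Set.mem_compl_iff, Finset.mem_coe, Finset.mem_image, not_exists,
        not_and, Finset.mem_erase] at hb ⊢
      rintro t ht rfl
      by_cases hts : t = s
      · exact hbs (hts ▸ rfl)
      · exact hb t ⟨hts, ht⟩ rfl

lemma exists_isChainMap (hE : M.E = Set.univ) :
    ∃ q, IsChainMap (properBoolean n \ properFlats M) (properBoolean n \ nonSpanning M) q := by
  classical
  -- For `n = 0` there is no default value for the choice function `a`, but there are no proper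
  -- subsets either.
  rcases isEmpty_or_nonempty (Fin n) with hn | hn
  · exact ⟨fun _ => ∅, fun _ _ _ => le_rfl, fun c _ _ _ => (Subsingleton.elim _ _).le,
      fun c hne hc _ => absurd (Subsingleton.elim _ _) (hc _ hne.choose_spec).1.1⟩
  have hex : ∀ s : Finset (Fin n), ∃ a, s ∈ properBoolean n \ properFlats M →
      a ∈ M.closure s ∧ a ∉ s := fun s => by
    by_cases hs : s ∈ properBoolean n \ properFlats M
    · obtain ⟨a, h⟩ := exists_mem_closure_notMem hE hs
      exact ⟨a, fun _ => h⟩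
    · exact ⟨Classical.arbitrary _, fun h => absurd h hs⟩
  choose a ha using hex
  have hinf : ∀ c : Finset (Finset (Fin n)), c.Nonempty →
      (∀ s ∈ c, s ∈ properBoolean n \ properFlats M) →
      IsChain (· ≤ ·) (c : Set (Finset (Fin n))) → c.inf id ≤ (c.image a)ᶜ := by
    intro c _ hcQ _ b hb
    simp only [Finset.mem_compl, Finset.mem_image, not_exists, not_and]
    rintro s hs rfl
    exact (ha s (hcQ s hs)).2 (Finset.inf_le (f := id) hs hb)
  refine ⟨fun c => (c.image a)ᶜ,
    fun c d h => Finset.compl_subset_compl.2 (Finset.image_subset_image h), hinf,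
    fun c hne hcQ hc => (mem_properBoolean_diff_nonSpanning hE).2 ⟨⟨?_, ?_⟩,
      spanning_compl_image_of_isChain hE c (fun s hs => ha s (hcQ s hs)) hc⟩⟩
  -- The image contains the minimum of the chain, which is nonempty.
  · have hmem := hcQ _ (inf_id_mem_of_isChain hne hc)
    exact (Finset.Nonempty.mono (hinf c hne hcQ hc)
      (Finset.nonempty_iff_ne_empty.2 hmem.1.1)).ne_empty
  · rw [Ne, Finset.compl_eq_univ_iff, Finset.image_eq_empty]
    exact hne.ne_empty

/-- Chains of proper spanning sets have at most `n - r` members. -/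
lemma dimLE_orderComplex_spanning {r : ℕ} (hE : M.E = Set.univ) (hr : M.eRank = (r : ℕ∞)) :
    DimLE (orderComplex (properBoolean n \ nonSpanning M)) ((n : ℤ) - (r : ℤ) - 1) := by
  intro s hs
  obtain ⟨c, ⟨hne, hcP, hc⟩, rfl⟩ := mem_faces_orderComplex.1 hs
  have hcard : ∀ t ∈ c, t.card ∈ Finset.Ico r n := by
    intro t ht
    obtain ⟨h1, h2⟩ := (mem_properBoolean_diff_nonSpanning hE).1 (hcP t ht)
    refine Finset.mem_Ico.2 ⟨?_, ?_⟩
    · have := M.eRk_le_encard (t : Set (Fin n))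
      rw [h2.eRk_eq, hr, Set.encard_coe_eq_coe_finsetCard] at this
      exact_mod_cast this
    · simpa using Finset.card_lt_univ_of_notMem
        (Classical.not_forall.1 fun h => h1.2 (Finset.eq_univ_iff_forall.2 h)).choose_spec
  have hinj : Set.InjOn Finset.card (c : Set (Finset (Fin n))) := by
    intro s hs t ht h
    rcases hc.total hs ht with hst | hst
    · exact Finset.eq_of_subset_of_card_le hst h.ge
    · exact (Finset.eq_of_subset_of_card_le hst h.le).symm
  have h1 : c.card ≤ n - r := by
    rw [← Nat.card_Ico]
    exact Finset.card_le_card_of_injOn _ hcard hinj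
  obtain ⟨t, ht⟩ := hne
  -- A member of the chain forces `r < n`, so the truncated subtraction in `h1` is exact.
  have h2 := Finset.mem_Ico.1 (hcard t ht)
  have h3 : (c.image fun a => (Pi.single a (1 : ℝ) : Finset (Fin n) → ℝ)).card ≤ c.card :=
    Finset.card_image_le
  omega

end Matroid

end MatroidComplement

theorem mainTheorem10 (n r : ℕ) (M : Matroid (Fin n)) (hE : M.E = Set.univ)
    (hloop : M.Loopless) (hr : M.eRank = (r : ℕ∞)) :
    Nonempty (ContinuousMap.HomotopyEquiv
      (((MatroidComplement.orderComplex (MatroidComplement.properBoolean n)).space \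
        (MatroidComplement.orderComplex (MatroidComplement.properFlats M)).space :
          Set (Finset (Fin n) → ℝ)))
      ((MatroidComplement.deletion
        (MatroidComplement.orderComplex (MatroidComplement.properBoolean n))
        (MatroidComplement.orderComplex (MatroidComplement.properFlats M))).space)) ∧
    Nonempty (ContinuousMap.HomotopyEquiv
      ((MatroidComplement.deletion
        (MatroidComplement.orderComplex (MatroidComplement.properBoolean n))
        (MatroidComplement.orderComplex (MatroidComplement.properFlats M))).space)
      ((MatroidComplement.deletion
        (MatroidComplement.orderComplex (MatroidComplement.properBoolean n))
        (MatroidComplement.orderComplex (MatroidComplement.nonSpanning M))).space)) ∧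
    MatroidComplement.DimLE
      (MatroidComplement.deletion
        (MatroidComplement.orderComplex (MatroidComplement.properBoolean n))
        (MatroidComplement.orderComplex (MatroidComplement.nonSpanning M)))
      ((n : ℤ) - (r : ℤ) - 1) := by
  rw [MatroidComplement.deletion_orderComplex, MatroidComplement.deletion_orderComplex]
  obtain ⟨q, hq⟩ := MatroidComplement.exists_isChainMap hE
  exact ⟨MatroidComplement.nonempty_homotopyEquiv_complement _ _,
    hq.nonempty_homotopyEquiv (MatroidComplement.properBoolean_diff_nonSpanning_subset hE),
    MatroidComplement.dimLE_orderComplex_spanning hE hr⟩
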